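/- **Theorem.** Let $n\ge 2$ and view $[n]=\{1,\dots,n\}$, in its cyclic order, as the vertices of a convex $n$-gon. A sequence $(i,j,k,\ell)$ of distinct elements of $[n]$ is *cyclic* if one of its cyclic rotations is strictly increasing. Let $\mathcal A_n$ be the unital associative $\mathbb Q$-algebra generated by $x_{ij}$ and $x_{ij}^{-1}$ ($i,j\in[n]$, $i\neq j$), where $x_{ij}^{-1}$ is a two-sided inverse of $x_{ij}$, subject to * $x_{ij}x_{kj}^{-1}x_{ki}=x_{ik}x_{jk}^{-1}x_{ji}$ for all distinct $i,j,k\in[n]$; * $x_{j\ell}=x_{jk}x_{ik}^{-1}x_{i\ell}+x_{ji}x_{ki}^{-1}x_{k\ell}$ for all cyclic $(i,j,k,\ell)$ in $[n]$. A pair $(i,k)$ *crosses* $(j,\ell)$ if $(i,j,k,\ell)$ is cyclic, and a *triangulation* $\Delta$ of the $n$-gon is a maximal crossing-free subset of $\{(i,j)\in[n]\times[n] : i\ne j\}$. For a triangulation $\Delta$, let $\mathcal A_\Delta\subset\mathcal A_n$ be the subalgebra generated by all $x_{ij}$ ($i,j\in[n]$, $i\ne j$) and all $x_{ij}^{-1}$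 with $(i,j)\in\Delta$, and let $\mathbb T_\Delta$ be the group generated by $t_{ij}$, $(i,j)\in\Delta$, subject to the relations $t_{ij}t_{kj}^{-1}t_{ki}=t_{ik}t_{jk}^{-1}t_{ji}$ for all $i,j,k\in[n]$ with $(i,j),(j,k),(k,i)\in\Delta$. Then for every triangulation $\Delta$ of the $n$-gon: (a) The algebra homomorphism $\mathbf i_\Delta:\mathbb Q\mathbb T_\Delta\to\mathcal A_\Delta$ from the group algebra of $\mathbb T_\Delta$, given by $t_{ij}\mapsto x_{ij}$ for $(i,j)\in\Delta$, is an isomorphism. (b) $\mathcal A_n=\mathcal A_\Delta[\mathbf S^{-1}]$, where $\mathbf S$ is the multiplicative submonoid of $\mathcal A_\Delta$ generated by all $x_{ij}$ ($i,j\in[n]$, $i\neq j$). That is, the inclusion $\mathcal A_\Delta\hookrightarrow\mathcal A_n$ is the universal localization of $\mathcal A_\Delta$ by $\mathbf S$: it sends every element of $\mathbf S$ to an invertible element, and every ring homomorphism $g:\mathcal A_\Delta\to R'$ to a unital ring $R'$ such that $g(s)$ is invertible for all $s\in\mathbf S$ extends uniquely to a ring homomorphism $\mathcal A_n\to R'$.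 -/

import Mathlib

universe v u w

namespace NCPolygon

/-- The sequence `(i, j, k, l)` of vertices of the `n`-gon is cyclic: one of its cyclic rotations is
strictly increasing. The vertices are `0, …, n - 1`, in this cyclic order. -/
def IsCyclicQuad {n : ℕ} (i j k l : Fin n) : Prop :=
  (i < j ∧ j < k ∧ k < l) ∨ (j < k ∧ k < l ∧ l < i) ∨
    (k < l ∧ l < i ∧ i < j) ∨ (l < i ∧ i < j ∧ j < k)

/-- The directed chord `p = (i, k)` crosses `q = (j, l)` if `(i, j, k, l)` is cyclic. -/
def Crosses {n : ℕ} (p q : Fin n × Fin n) : Prop :=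
  IsCyclicQuad p.1 q.1 p.2 q.2

/-- A crossing-free set of pairs of distinct vertices. -/
def CrossingFree {n : ℕ} (s : Set (Fin n × Fin n)) : Prop :=
  (∀ p ∈ s, p.1 ≠ p.2) ∧ ∀ p ∈ s, ∀ q ∈ s, ¬ Crosses p q

/-- A triangulation of the `n`-gon: a maximal crossing-free set of pairs of distinct vertices. -/
structure Triangulation (n : ℕ) where
  /-- the set of directed chords (sides and diagonals) of the triangulation -/
  chords : Set (Fin n × Fin n)
  maximal : Maximal CrossingFree chords

namespace Triangulation

theorem ne {n : ℕ} (Δ : Triangulation n) {i j : Fin n} (h : (i, j) ∈ Δ.chords) : i ≠ j :=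
  Δ.maximal.prop.1 _ h

/-- A triangulation is closed under reversing chords. -/
theorem swap_mem {n : ℕ} (Δ : Triangulation n) {i j : Fin n} (h : (i, j) ∈ Δ.chords) :
    (j, i) ∈ Δ.chords := by
  have hcf : CrossingFree (insert (j, i) Δ.chords) := by
    have hne := Δ.ne h
    have hc := Δ.maximal.prop.2
    refine ⟨?_, ?_⟩
    · rintro p (rfl | hp)
      · exact hne.symm
      · exact Δ.maximal.prop.1 _ hp
    · rintro p (rfl | hp) q (rfl | hq)
      · simp only [Crosses, IsCyclicQuad]; omega
      · have h1 := hc _ h _ hq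
        have h2 := hc _ hq _ h
        simp only [Crosses, IsCyclicQuad] at *; omega
      · have h1 := hc _ h _ hp
        have h2 := hc _ hp _ h
        simp only [Crosses, IsCyclicQuad] at *; omega
      · exact hc _ hp _ hq
  exact Δ.maximal.2 hcf (Set.subset_insert _ _) (Set.mem_insert _ _)

end Triangulation

/-! ### The algebra of the noncommutative polygon -/

/-- Generators of the noncommutative polygon algebra: `x i j` and `xInv i j` for `i ≠ j`. -/
inductive Gen (n : ℕ) : Type
  | x (i j : Fin n) (h : i ≠ j) : Gen n
  | xInv (i j : Fin n) (h : i ≠ j) : Gen n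

/-- The generator `x i j` in the free algebra. -/
abbrev fx {n : ℕ} (i j : Fin n) (h : i ≠ j) : FreeAlgebra ℚ (Gen n) :=
  FreeAlgebra.ι ℚ (Gen.x i j h)

/-- The generator `xInv i j` in the free algebra. -/
abbrev fxInv {n : ℕ} (i j : Fin n) (h : i ≠ j) : FreeAlgebra ℚ (Gen n) :=
  FreeAlgebra.ι ℚ (Gen.xInv i j h)

/-- Defining relations: `xInv i j` is the two-sided inverse of `x i j`, the triangle relations
and the exchange relations. In `exchange` distinctness of the indices follows from `IsCyclicQuad`;
it is repeated only in order to form the generators. -/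
inductive Rel (n : ℕ) : FreeAlgebra ℚ (Gen n) → FreeAlgebra ℚ (Gen n) → Prop
  | mul_inv (i j : Fin n) (h : i ≠ j) : Rel n (fx i j h * fxInv i j h) 1
  | inv_mul (i j : Fin n) (h : i ≠ j) : Rel n (fxInv i j h * fx i j h) 1
  | triangle (i j k : Fin n) (hij : i ≠ j) (hik : i ≠ k) (hjk : j ≠ k) :
      Rel n (fx i j hij * fxInv k j hjk.symm * fx k i hik.symm)
        (fx i k hik * fxInv j k hjk * fx j i hij.symm)
  | exchange (i j k l : Fin n) (hcyc : IsCyclicQuad i j k l)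
      (hij : i ≠ j) (hik : i ≠ k) (hil : i ≠ l) (hjk : j ≠ k) (hjl : j ≠ l) (hkl : k ≠ l) :
      Rel n (fx j l hjl)
        (fx j k hjk * fxInv i k hik * fx i l hil + fx j i hij.symm * fxInv k i hik.symm * fx k l hkl)

/-- The `ℚ`-algebra `𝒜_n` of the noncommutative `n`-gon. -/
def PolygonAlgebra (n : ℕ) : Type := RingQuot (Rel n)

noncomputable instance (n : ℕ) : Ring (PolygonAlgebra n) :=
  inferInstanceAs (Ring (RingQuot (Rel n)))

noncomputable instance (n : ℕ) : Algebra ℚ (PolygonAlgebra n) :=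
  inferInstanceAs (Algebra ℚ (RingQuot (Rel n)))

/-- The quotient map from the free algebra onto `𝒜_n`. -/
noncomputable def mk (n : ℕ) : FreeAlgebra ℚ (Gen n) →ₐ[ℚ] PolygonAlgebra n :=
  RingQuot.mkAlgHom ℚ (Rel n)

theorem mk_rel {n : ℕ} {a b : FreeAlgebra ℚ (Gen n)} (h : Rel n a b) : mk n a = mk n b :=
  RingQuot.mkAlgHom_rel ℚ h

/-- The element `x_{ij}` of `𝒜_n`. -/
noncomputable def x {n : ℕ} (i j : Fin n) (h : i ≠ j) : PolygonAlgebra n :=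
  mk n (fx i j h)

/-- The element `x_{ij}⁻¹` of `𝒜_n`. -/
noncomputable def xInv {n : ℕ} (i j : Fin n) (h : i ≠ j) : PolygonAlgebra n :=
  mk n (fxInv i j h)

theorem x_mul_xInv {n : ℕ} (i j : Fin n) (h : i ≠ j) : x i j h * xInv i j h = 1 := by
  simpa [x, xInv] using mk_rel (Rel.mul_inv i j h)

theorem xInv_mul_x {n : ℕ} (i j : Fin n) (h : i ≠ j) : xInv i j h * x i j h = 1 := by
  simpa [x, xInv] using mk_rel (Rel.inv_mul i j h)

theorem x_triangle {n : ℕ} (i j k : Fin n) (hij : i ≠ j) (hik : i ≠ k) (hjk : j ≠ k) :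
    x i j hij * xInv k j hjk.symm * x k i hik.symm =
      x i k hik * xInv j k hjk * x j i hij.symm := by
  simpa [x, xInv] using mk_rel (Rel.triangle i j k hij hik hjk)

namespace Triangulation

/-- The subalgebra `𝒜_Δ` of `𝒜_n` generated by all `x_{ij}`, `i ≠ j`, and by the `x_{ij}⁻¹` with
`(i, j) ∈ Δ`. -/
noncomputable def subalgebra {n : ℕ} (Δ : Triangulation n) : Subalgebra ℚ (PolygonAlgebra n) :=
  Algebra.adjoin ℚ
    ({a | ∃ (i j : Fin n) (h : i ≠ j), a = x i j h} ∪
      {a | ∃ (i j : Fin n) (h : (i, j) ∈ Δ.chords), a = xInv i j (Δ.ne h)})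

/-- The inclusion `𝒜_Δ → 𝒜_n` as a ring homomorphism. -/
noncomputable def inclusion {n : ℕ} (Δ : Triangulation n) : Δ.subalgebra →+* PolygonAlgebra n :=
  Δ.subalgebra.val

/-- The submonoid of `𝒜_Δ` generated by all `x_{ij}`, `i ≠ j`. -/
noncomputable def xMonoid {n : ℕ} (Δ : Triangulation n) : Submonoid Δ.subalgebra :=
  Submonoid.closure {a | ∃ (i j : Fin n) (h : i ≠ j), (a : PolygonAlgebra n) = x i j h}

/-- The relators `(t_{ij} t_{kj}⁻¹ t_{ki}) (t_{ik} t_{jk}⁻¹ t_{ji})⁻¹` of the triangle group, for all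
`i, j, k` with `(i, j), (j, k), (k, i) ∈ Δ`. -/
def triangleRels {n : ℕ} (Δ : Triangulation n) : Set (FreeGroup Δ.chords) :=
  {r | ∃ (i j k : Fin n) (hij : (i, j) ∈ Δ.chords) (hjk : (j, k) ∈ Δ.chords)
      (hki : (k, i) ∈ Δ.chords),
    r = (FreeGroup.of ⟨(i, j), hij⟩ * (FreeGroup.of ⟨(k, j), Δ.swap_mem hjk⟩)⁻¹ *
          FreeGroup.of ⟨(k, i), hki⟩) *
        (FreeGroup.of ⟨(i, k), Δ.swap_mem hki⟩ * (FreeGroup.of ⟨(j, k), hjk⟩)⁻¹ *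
          FreeGroup.of ⟨(j, i), Δ.swap_mem hij⟩)⁻¹}

/-- The triangle group `𝕋_Δ`. -/
abbrev TriangleGroup {n : ℕ} (Δ : Triangulation n) : Type := PresentedGroup Δ.triangleRels

/-- `x_{ij}`, for `(i, j) ∈ Δ`, as a unit of `𝒜_Δ`. -/
noncomputable def xUnit {n : ℕ} (Δ : Triangulation n) (p : Δ.chords) : (Δ.subalgebra)ˣ where
  val := ⟨x p.1.1 p.1.2 (Δ.ne p.2), Algebra.subset_adjoin (Or.inl ⟨_, _, _, rfl⟩)⟩
  inv := ⟨xInv p.1.1 p.1.2 (Δ.ne p.2), Algebra.subset_adjoin (Or.inr ⟨_, _, p.2, rfl⟩)⟩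
  val_inv := Subtype.ext (x_mul_xInv _ _ _)
  inv_val := Subtype.ext (xInv_mul_x _ _ _)

theorem xUnit_rels {n : ℕ} (Δ : Triangulation n) :
    ∀ r ∈ Δ.triangleRels, FreeGroup.lift Δ.xUnit r = 1 := by
  rintro r ⟨i, j, k, hij, hjk, hki, rfl⟩
  simp only [map_mul, map_inv, FreeGroup.lift_apply_of]
  rw [mul_inv_eq_one]
  exact Units.ext (Subtype.ext (x_triangle i j k (Δ.ne hij) (Δ.ne hki).symm (Δ.ne hjk)))

/-- The algebra homomorphism `𝐢_Δ : ℚ𝕋_Δ → 𝒜_Δ` with `t_{ij} ↦ x_{ij}` for `(i, j) ∈ Δ`. -/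
noncomputable def iHom {n : ℕ} (Δ : Triangulation n) :
    MonoidAlgebra ℚ Δ.TriangleGroup →ₐ[ℚ] Δ.subalgebra :=
  MonoidAlgebra.lift ℚ Δ.subalgebra Δ.TriangleGroup
    ((Units.coeHom Δ.subalgebra).comp (PresentedGroup.toGroup Δ.xUnit_rels))

theorem iHom_of {n : ℕ} (Δ : Triangulation n) {i j : Fin n} (h : (i, j) ∈ Δ.chords) :
    (Δ.iHom (MonoidAlgebra.of ℚ Δ.TriangleGroup (PresentedGroup.of ⟨(i, j), h⟩)) :
      PolygonAlgebra n) = x i j (Δ.ne h) := by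
  simp [iHom, xUnit]

end Triangulation

/-- `f : R → B` exhibits `B` as the universal localization `R[S⁻¹]` of the (noncommutative) ring `R`
by the submonoid `S`: `f` makes all elements of `S` invertible and is universal (initial) among the
ring homomorphisms from `R` to rings in `Type v` with this property. -/
def IsUniversalLocalization {R : Type u} {B : Type w} [Ring R] [Ring B]
    (S : Submonoid R) (f : R →+* B) : Prop :=
  (∀ s ∈ S, IsUnit (f s)) ∧
    ∀ (R' : Type v) [Ring R'] (g : R →+* R'), (∀ s ∈ S, IsUnit (g s)) →
      ∃! h : B →+* R', h.comp f = g

end NCPolygon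

/-! Give `x i j` the sign of `j - i` and put zeros on the diagonal. The triangle and exchange
relations then merge into one family (`IsPolygon`): every row of the matrix is a prescribed left
combination of any two others. This is a rank two condition, so it follows as soon as all rows are
combinations of just two (`RowsSpanned.isPolygon`).

Cutting along `Δ` from the side `(0, n - 1)` makes the remaining vertices a binary tree: `c` is the
middle vertex of one triangle `a < c < b`. Expanding rows and columns along this tree expresses
every entry through chords of `Δ` and their inverses (`IsExtension.mem`), so `iHom` is surjective.
Conversely, a representation of the triangle group extends along the tree to a full matrix
(`IsTriangleRep.exists_isExtension`), and this matrix represents the polygon algebra once its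
off-diagonal entries are invertible (`isPolygon_of_row`).

For injectivity, grade the triangle group by `t i j ↦ min i j` and embed it homogeneously in Laurent
series over its group algebra. In each exchange step one of the two terms has strictly smaller
order, so every off-diagonal entry has an invertible leading coefficient
(`IsExtension.hasUnitLead`). The resulting representation restricts to an injective map on the group
algebra.

For the localization, a homomorphism inverting all `x i j` preserves the row expansions, which
invert chords only; its values thus form a polygon matrix and define the extension. -/

namespace NCPolygon

/-! ### The binary tree of triangles of a triangulation. -/

namespace Triangulation

variable {n : ℕ} (Δ : Triangulation n)

theorem not_crosses {i j k l : Fin n} (h : (i, k) ∈ Δ.chords) (h' : (j, l) ∈ Δ.chords) :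
    ¬ IsCyclicQuad i j k l :=
  Δ.maximal.prop.2 _ h _ h'

/-- A chord that crosses no chord of a triangulation belongs to it. -/
theorem mem_of_not_crosses {i k : Fin n} (hik : i ≠ k)
    (h : ∀ j l, (j, l) ∈ Δ.chords → ¬ IsCyclicQuad i j k l) : (i, k) ∈ Δ.chords := by
  have hcf : CrossingFree (insert (i, k) Δ.chords) := by
    refine ⟨?_, ?_⟩
    · rintro p (rfl | hp)
      · exact hik
      · exact Δ.maximal.prop.1 _ hp
    · rintro _ (rfl | hp) q (rfl | hq)
      · simp only [Crosses, IsCyclicQuad]; omega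
      · exact h _ _ hq
      · have h1 := h _ _ (Δ.swap_mem hp)
        simp only [Crosses, IsCyclicQuad] at *; omega
      · exact Δ.maximal.prop.2 _ hp _ hq
  exact Δ.maximal.2 hcf (Set.subset_insert _ _) (Set.mem_insert _ _)

theorem mem_of_succ {i k : Fin n} (h : i.val + 1 = k.val) : (i, k) ∈ Δ.chords :=
  Δ.mem_of_not_crosses (by intro h'; omega) fun j l _ => by simp only [IsCyclicQuad]; omega

theorem mem_root {i k : Fin n} (hi : i.val = 0) (hk : k.val + 1 = n) (hik : i ≠ k) :
    (i, k) ∈ Δ.chords :=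
  Δ.mem_of_not_crosses hik fun j l _ => by simp only [IsCyclicQuad]; omega

/-- `a < c < b` are the vertices of the triangle of `Δ` with middle vertex `c`: the least and
the greatest neighbour of `c` are `a` and `b`. -/
structure Parents (c a b : Fin n) : Prop where
  lt_left : a < c
  lt_right : c < b
  left_mem : (a, c) ∈ Δ.chords
  right_mem : (c, b) ∈ Δ.chords
  base_mem : (a, b) ∈ Δ.chords
  bounds : ∀ d, (c, d) ∈ Δ.chords → a ≤ d ∧ d ≤ b

theorem exists_parents {c : Fin n} (h0 : c.val ≠ 0) (h1 : c.val + 1 ≠ n) :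
    ∃ a b, Δ.Parents c a b := by
  classical
  set N : Finset (Fin n) := Finset.univ.filter fun d => (c, d) ∈ Δ.chords with hN
  have hl : (c, (⟨c.val - 1, by omega⟩ : Fin n)) ∈ Δ.chords :=
    Δ.swap_mem (Δ.mem_of_succ (by simp only; omega))
  have hr : (c, (⟨c.val + 1, by omega⟩ : Fin n)) ∈ Δ.chords := Δ.mem_of_succ rfl
  have hne : N.Nonempty := ⟨_, by simpa [hN] using hl⟩
  have hmin := N.min'_mem hne
  have hmax := N.max'_mem hne
  have hmin' : ∀ d, (c, d) ∈ Δ.chords → N.min' hne ≤ d := fun d hd =>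
    N.min'_le d (by simpa [hN] using hd)
  have hmax' : ∀ d, (c, d) ∈ Δ.chords → d ≤ N.max' hne := fun d hd =>
    N.le_max' d (by simpa [hN] using hd)
  generalize N.min' hne = a at *
  generalize N.max' hne = b at *
  have ha : (c, a) ∈ Δ.chords := by simpa [hN] using hmin
  have hb : (c, b) ∈ Δ.chords := by simpa [hN] using hmax
  have hal := hmin' _ hl
  have hbl := hmax' _ hr
  rw [Fin.le_def] at hal hbl
  simp only at hal hbl
  refine ⟨a, b, by omega, by omega, Δ.swap_mem ha, hb, ?_, fun d hd => ⟨hmin' d hd, hmax' d hd⟩⟩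
  -- A chord crossing `(a, b)` has `p` strictly between `a` and `b` and `q` outside. If `p ≠ c` it
  -- crosses `(c, a)` or `(c, b)`; if `p = c` then `q` violates the extremality of `a` and `b`.
  refine Δ.mem_of_not_crosses (by omega) fun p q hpq hc => ?_
  have hc' : a < p ∧ p < b ∧ (q < a ∨ b < q) := by
    simp only [IsCyclicQuad] at hc; omega
  clear hc
  rcases lt_trichotomy p c with hp | rfl | hp
  · refine Δ.not_crosses (Δ.swap_mem ha) hpq ?_
    simp only [IsCyclicQuad]; omega
  · have := hmin' _ hpq
    have := hmax' _ hpq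
    omega
  · refine Δ.not_crosses hb hpq ?_
    simp only [IsCyclicQuad]; omega

variable {Δ}

theorem Parents.unique {c a b a' b' : Fin n} (h : Δ.Parents c a b) (h' : Δ.Parents c a' b') :
    a = a' ∧ b = b' :=
  ⟨le_antisymm (h.bounds _ (Δ.swap_mem h'.left_mem)).1 (h'.bounds _ (Δ.swap_mem h.left_mem)).1,
    le_antisymm (h'.bounds _ h.right_mem).2 (h.bounds _ h'.right_mem).2⟩

/-- A chord of `Δ` other than `(0, n - 1)` joins a vertex to its least or greatest neighbour. -/
theorem chord_cases {i j : Fin n} (hij : i < j) (h : (i, j) ∈ Δ.chords) :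
    (i.val = 0 ∧ j.val + 1 = n) ∨ (∃ b, Δ.Parents j i b) ∨ ∃ a, Δ.Parents i a j := by
  by_cases hi : i.val = 0
  · by_cases hj : j.val + 1 = n
    · exact Or.inl ⟨hi, hj⟩
    · obtain ⟨a, b, hp⟩ := Δ.exists_parents (c := j) (by omega) hj
      have := (hp.bounds _ (Δ.swap_mem h)).1
      obtain rfl : a = i := by omega
      exact Or.inr (Or.inl ⟨b, hp⟩)
  · obtain ⟨a, b, hp⟩ := Δ.exists_parents (c := i) hi (by omega)
    by_cases hj : j.val + 1 = n
    · have := (hp.bounds _ h).2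
      obtain rfl : b = j := by omega
      exact Or.inr (Or.inr ⟨a, hp⟩)
    · obtain ⟨a', b', hp'⟩ := Δ.exists_parents (c := j) (by omega) hj
      have h1 := (hp.bounds _ h).2
      have h2 := (hp'.bounds _ (Δ.swap_mem h)).1
      have h3 := Δ.not_crosses hp'.left_mem hp.right_mem
      have h4 := hp'.lt_right
      by_cases h5 : a' = i
      · subst h5; exact Or.inr (Or.inl ⟨b', hp'⟩)
      -- Here `a' < i`, so `j < b` would make `(a', j)` and `(i, b)` cross.
      · have h6 : b = j := by simp only [IsCyclicQuad] at h3; omega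
        subst h6; exact Or.inr (Or.inr ⟨a, hp⟩)

variable (Δ)

/-- The depth of a vertex in the binary tree of triangles of `Δ` (up to monotone reparametrization):
it decreases from a vertex to its parents. -/
noncomputable def depth (c : Fin n) : ℕ := by
  classical exact
    if h : ∃ p : Fin n × Fin n, Δ.Parents c p.1 p.2 then n - (h.choose.2.val - h.choose.1.val) else 0

variable {Δ}

theorem Parents.depth_eq {c a b : Fin n} (h : Δ.Parents c a b) :
    Δ.depth c = n - (b.val - a.val) := by
  have hex : ∃ p : Fin n × Fin n, Δ.Parents c p.1 p.2 := ⟨(a, b), h⟩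
  obtain ⟨h1, h2⟩ := h.unique hex.choose_spec
  rw [depth, dif_pos hex, ← h1, ← h2]

theorem depth_eq_zero {c : Fin n} (h : ¬ ∃ a b, Δ.Parents c a b) : Δ.depth c = 0 :=
  dif_neg fun ⟨_, hp⟩ => h ⟨_, _, hp⟩

/-- As `b` is a neighbour of `a`, parents `a'`, `b'` of `a` satisfy `a' < a` and `b ≤ b'`: bases get
strictly wider towards the root. -/
theorem Parents.depth_left_lt {c a b : Fin n} (h : Δ.Parents c a b) : Δ.depth a < Δ.depth c := by
  rw [h.depth_eq]
  by_cases ha : ∃ a' b', Δ.Parents a a' b'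
  · obtain ⟨a', b', h'⟩ := ha
    rw [h'.depth_eq]
    have := (h'.bounds _ h.base_mem).2
    have := h'.lt_left
    have := h.lt_left
    have := h.lt_right
    omega
  · rw [depth_eq_zero ha]
    omega

theorem Parents.depth_right_lt {c a b : Fin n} (h : Δ.Parents c a b) : Δ.depth b < Δ.depth c := by
  rw [h.depth_eq]
  by_cases ha : ∃ a' b', Δ.Parents b a' b'
  · obtain ⟨a', b', h'⟩ := ha
    rw [h'.depth_eq]
    have := (h'.bounds _ (Δ.swap_mem h.base_mem)).1
    have := h'.lt_right
    have := h.lt_left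
    have := h.lt_right
    omega
  · rw [depth_eq_zero ha]
    omega

variable (Δ)

theorem tree_induction {P : Fin n → Prop} (h0 : ∀ c : Fin n, c.val = 0 → P c)
    (h1 : ∀ c : Fin n, c.val + 1 = n → P c)
    (ih : ∀ c a b, Δ.Parents c a b → P a → P b → P c) (c : Fin n) : P c := by
  induction hd : Δ.depth c using Nat.strong_induction_on generalizing c with
  | _ d IH =>
    subst hd
    by_cases hc0 : c.val = 0
    · exact h0 c hc0
    by_cases hc1 : c.val + 1 = n
    · exact h1 c hc1
    obtain ⟨a, b, h⟩ := Δ.exists_parents hc0 hc1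
    exact ih c a b h (IH _ h.depth_left_lt a rfl) (IH _ h.depth_right_lt b rfl)

open Classical in
/-- Recursion along the binary tree of triangles of `Δ`. -/
noncomputable def treeRec {X : Type*} (u v : X) (F : Fin n → Fin n → Fin n → X → X → X)
    (c : Fin n) : X :=
  if h : ∃ p : Fin n × Fin n, Δ.Parents c p.1 p.2 then
    F c h.choose.1 h.choose.2 (treeRec u v F h.choose.1) (treeRec u v F h.choose.2)
  else if c.val = 0 then u else v
termination_by Δ.depth c
decreasing_by
  · exact h.choose_spec.depth_left_lt
  · exact h.choose_spec.depth_right_lt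

variable {Δ}

theorem Parents.treeRec_eq {X : Type*} (u v : X) (F : Fin n → Fin n → Fin n → X → X → X)
    {c a b : Fin n} (h : Δ.Parents c a b) :
    Δ.treeRec u v F c = F c a b (Δ.treeRec u v F a) (Δ.treeRec u v F b) := by
  have hex : ∃ p : Fin n × Fin n, Δ.Parents c p.1 p.2 := ⟨(a, b), h⟩
  obtain ⟨h1, h2⟩ := h.unique hex.choose_spec
  rw [treeRec, dif_pos hex, ← h1, ← h2]

theorem treeRec_zero {X : Type*} (u v : X) (F : Fin n → Fin n → Fin n → X → X → X)
    {c : Fin n} (h : c.val = 0) : Δ.treeRec u v F c = u := by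
  rw [treeRec, dif_neg, if_pos h]
  rintro ⟨p, hp⟩
  have := hp.lt_left
  omega

theorem treeRec_last {X : Type*} (u v : X) (F : Fin n → Fin n → Fin n → X → X → X)
    {c : Fin n} (h : c.val + 1 = n) (h0 : c.val ≠ 0) : Δ.treeRec u v F c = v := by
  rw [treeRec, dif_neg, if_neg h0]
  rintro ⟨p, hp⟩
  have := hp.lt_right
  omega

end Triangulation
-- Matrices of rank two over a noncommutative ring.
section RankTwo

variable {ι : Type*} {R : Type*} [Ring R]

theorem ringInverse_eq {a b : R} (h : a * b = 1) (h' : b * a = 1) : Ring.inverse a = b :=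
  Ring.inverse_unit ⟨a, b, h, h'⟩

theorem ringInverse_neg (a : R) : Ring.inverse (-a) = -Ring.inverse a := by
  by_cases h : IsUnit a
  · exact ringInverse_eq (by simp [Ring.mul_inverse_cancel a h])
      (by simp [Ring.inverse_mul_cancel a h])
  · rw [Ring.inverse_non_unit a h, Ring.inverse_non_unit _ (by simpa using h), neg_zero]

theorem map_ringInverse {S F : Type*} [Ring S] [FunLike F R S] [RingHomClass F R S] (f : F) {a : R}
    (h : IsUnit a) : f (Ring.inverse a) = Ring.inverse (f a) :=
  (ringInverse_eq (by rw [← map_mul, Ring.mul_inverse_cancel a h, map_one])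
    (by rw [← map_mul, Ring.inverse_mul_cancel a h, map_one])).symm

/-- A square matrix `m` with zero diagonal and invertible off-diagonal entries such that any row is
the left linear combination of any two other rows which is forced by its entries in the
corresponding columns. These are the signed forms of representations of the noncommutative
polygon. -/
structure IsPolygon (m : ι → ι → R) : Prop where
  diag (i : ι) : m i i = 0
  isUnit (i j : ι) (h : i ≠ j) : IsUnit (m i j)
  exchange (i k : ι) (h : i ≠ k) (j l : ι) :
    m j l = m j k * Ring.inverse (m i k) * m i l + m j i * Ring.inverse (m k i) * m k l

/-- All rows of `m` are left linear combinations of the rows `a` and `b`. -/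
def RowsSpanned (m : ι → ι → R) (a b : ι) : Prop :=
  ∀ j, ∃ α β : R, ∀ l, m j l = α * m a l + β * m b l

variable {m : ι → ι → R}

theorem RowsSpanned.symm {a b : ι} (h : RowsSpanned m a b) : RowsSpanned m b a := fun j => by
  obtain ⟨α, β, h⟩ := h j
  exact ⟨β, α, fun l => by rw [h, add_comm]⟩

/-- Evaluate in column `b`, where row `b` vanishes. -/
theorem RowsSpanned.coeff_left (hd : ∀ i, m i i = 0) {a b j : ι} (hab : IsUnit (m a b)) {α β : R}
    (h : ∀ l, m j l = α * m a l + β * m b l) : α = m j b * Ring.inverse (m a b) := by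
  rw [h b, hd b, mul_zero, add_zero, Ring.mul_inverse_cancel_right _ _ hab]

theorem RowsSpanned.exchange (hd : ∀ i, m i i = 0) (hu : ∀ i j, i ≠ j → IsUnit (m i j)) {a b : ι}
    (hab : a ≠ b) (h : RowsSpanned m a b) (j l : ι) :
    m j l = m j b * Ring.inverse (m a b) * m a l + m j a * Ring.inverse (m b a) * m b l := by
  obtain ⟨α, β, h⟩ := h j
  rw [← coeff_left hd (hu a b hab) h, ← coeff_left hd (hu b a hab.symm)
    (fun l => by rw [h l, add_comm] : ∀ l, m j l = β * m b l + α * m a l)]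
  exact h l

/-- Steinitz exchange: the coefficient of row `b` in row `k` is a unit because `k ≠ a`, so row `b`
can be solved for. -/
theorem RowsSpanned.replace (hd : ∀ i, m i i = 0) (hu : ∀ i j, i ≠ j → IsUnit (m i j)) {a b k : ι}
    (hab : a ≠ b) (hak : a ≠ k) (h : RowsSpanned m a b) : RowsSpanned m a k := by
  intro j
  have hk := fun l => h.exchange hd hu hab k l
  set γ := m k b * Ring.inverse (m a b)
  set δ := m k a * Ring.inverse (m b a) with hδ
  have hδu : IsUnit δ := (hu k a hak.symm).mul (hu b a hab.symm).ringInverse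
  obtain ⟨α, β, hj⟩ := h j
  refine ⟨α - β * Ring.inverse δ * γ, β * Ring.inverse δ, fun l => ?_⟩
  have hb : m b l = Ring.inverse δ * (m k l - γ * m a l) := by
    rw [hk l, add_sub_cancel_left, Ring.inverse_mul_cancel_left _ _ hδu]
  rw [hj l, hb]
  noncomm_ring

/-- If all rows are combinations of two of them, then the exchange relations hold for all pairs of
rows. -/
theorem RowsSpanned.isPolygon (hd : ∀ i, m i i = 0) (hu : ∀ i j, i ≠ j → IsUnit (m i j)) {a b : ι}
    (hab : a ≠ b) (h : RowsSpanned m a b) : IsPolygon m where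
  diag := hd
  isUnit := hu
  exchange i k hik := by
    by_cases hak : a = k
    · subst hak
      exact ((h.replace hd hu hab hik.symm).symm).exchange hd hu hik
    · exact ((h.replace hd hu hab hak).symm.replace hd hu (Ne.symm hak) hik.symm).symm.exchange
        hd hu hik

end RankTwo

/-! ### The polygon algebra as the universal signed polygon matrix. -/

section PolygonAlgebra

variable {n : ℕ}

theorem ringInverse_x (i j : Fin n) (h : i ≠ j) : Ring.inverse (x i j h) = xInv i j h :=
  ringInverse_eq (x_mul_xInv i j h) (xInv_mul_x i j h)

theorem isUnit_x (i j : Fin n) (h : i ≠ j) : IsUnit (x i j h) :=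
  ⟨⟨_, _, x_mul_xInv i j h, xInv_mul_x i j h⟩, rfl⟩

theorem x_exchange (i j k l : Fin n) (hcyc : IsCyclicQuad i j k l)
    (hij : i ≠ j) (hik : i ≠ k) (hil : i ≠ l) (hjk : j ≠ k) (hjl : j ≠ l) (hkl : k ≠ l) :
    x j l hjl = x j k hjk * xInv i k hik * x i l hil +
      x j i hij.symm * xInv k i hik.symm * x k l hkl := by
  simpa [x, xInv] using mk_rel (Rel.exchange i j k l hcyc hij hik hil hjk hjl hkl)

/-- The antisymmetric form of the generators: `x_{ij}` for `i < j`, `-x_{ij}` for `i > j`, and zero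
for `i = j`. -/
noncomputable def signedX (i j : Fin n) : PolygonAlgebra n :=
  if h : i = j then 0 else if i < j then x i j h else -x i j h

theorem signedX_self (i : Fin n) : signedX i i = 0 := dif_pos rfl

theorem signedX_of_lt {i j : Fin n} (h : i < j) : signedX i j = x i j h.ne := by
  rw [signedX, dif_neg h.ne, if_pos h]

theorem signedX_of_gt {i j : Fin n} (h : j < i) : signedX i j = -x i j h.ne' := by
  rw [signedX, dif_neg h.ne', if_neg h.not_gt]

theorem isUnit_signedX (i j : Fin n) (h : i ≠ j) : IsUnit (signedX i j) := by
  rw [signedX, dif_neg h]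
  split_ifs
  · exact isUnit_x i j h
  · exact (isUnit_x i j h).neg

/-- In each of the four rotations the signs of the three terms agree, so this is the defining
exchange relation up to a common sign. -/
theorem signedX_exchange_of_cyclic {i j k l : Fin n} (h : IsCyclicQuad i j k l) :
    signedX j l = signedX j k * Ring.inverse (signedX i k) * signedX i l +
      signedX j i * Ring.inverse (signedX k i) * signedX k l := by
  have hx := fun h1 h2 h3 h4 h5 h6 => x_exchange i j k l h h1 h2 h3 h4 h5 h6
  rcases h with ⟨h1, h2, h3⟩ | ⟨h1, h2, h3⟩ | ⟨h1, h2, h3⟩ | ⟨h1, h2, h3⟩ <;>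
  · have h4 := h1.trans h2
    have h5 := h2.trans h3
    have h6 := h4.trans h3
    simp only [signedX_of_lt, signedX_of_gt, h1, h2, h3, h4, h5, h6, ringInverse_neg,
      ringInverse_x, neg_mul, mul_neg, neg_neg]
    rw [hx] <;> first | omega | rfl | noncomm_ring

theorem signedX_exchange_of_cyclic_or {i j k l : Fin n}
    (h : IsCyclicQuad i j k l ∨ IsCyclicQuad k j i l) :
    signedX j l = signedX j k * Ring.inverse (signedX i k) * signedX i l +
      signedX j i * Ring.inverse (signedX k i) * signedX k l := by
  rcases h with h | h
  · exact signedX_exchange_of_cyclic h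
  · rw [signedX_exchange_of_cyclic h, add_comm]

theorem signedX_triangle {i j k : Fin n} (hij : i ≠ j) (hik : i ≠ k) (hjk : j ≠ k) :
    signedX j k * Ring.inverse (signedX i k) * signedX i j +
      signedX j i * Ring.inverse (signedX k i) * signedX k j = 0 := by
  have hx := x_triangle j k i hjk hij.symm hik.symm
  rcases lt_or_gt_of_ne hij with h1 | h1 <;> rcases lt_or_gt_of_ne hik with h2 | h2 <;>
    rcases lt_or_gt_of_ne hjk with h3 | h3 <;> first | omega | skip
  all_goals
    simp only [signedX_of_lt, signedX_of_gt, h1, h2, h3, ringInverse_neg,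
      ringInverse_x, neg_mul, mul_neg, neg_neg, hx]
    abel

-- Four points split into two pairs in three ways, and one of these splittings consists of crossing
-- chords; the alternatives record the partner of `j`.
set_option maxHeartbeats 400000 in
theorem cyclicQuad_cases {i j k l : Fin n} (hij : i ≠ j) (hik : i ≠ k) (hil : i ≠ l) (hjk : j ≠ k)
    (hjl : j ≠ l) (hkl : k ≠ l) :
    (IsCyclicQuad i j k l ∨ IsCyclicQuad k j i l) ∨ (IsCyclicQuad i j l k ∨ IsCyclicQuad l j i k) ∨
      (IsCyclicQuad k j l i ∨ IsCyclicQuad l j k i) := by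
  simp only [IsCyclicQuad]
  rcases lt_or_gt_of_ne hij with h1 | h1 <;> rcases lt_or_gt_of_ne hik with h2 | h2 <;>
    rcases lt_or_gt_of_ne hil with h3 | h3 <;> rcases lt_or_gt_of_ne hjk with h4 | h4 <;>
    rcases lt_or_gt_of_ne hjl with h5 | h5 <;> rcases lt_or_gt_of_ne hkl with h6 | h6 <;>
    clear hij hik hil hjk hjl hkl <;>
    first
    | exfalso; omega
    | simp [h1, h2, h3, h4, h5, h6, h1.not_gt, h2.not_gt, h3.not_gt, h4.not_gt, h5.not_gt, h6.not_gt]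

/-- If `(i, k)` separates `j` from `l`, this is a defining relation. Otherwise a crossing exchange
relation is solved for another of its entries with the help of a triangle relation. Coinciding
indices give tautologies or the triangle relation. -/
theorem isPolygon_signedX : IsPolygon (signedX (n := n)) where
  diag := signedX_self
  isUnit := isUnit_signedX
  exchange := by
    -- Here `(i, l)` separates `j` from `k`: the relation expands `m j k` through rows `i` and `l`.
    -- Substituting it on the right leaves `m j l` and two terms that cancel by the triangle
    -- relation for `i, l, k`.
    have key : ∀ i k l : Fin n, i ≠ k → i ≠ l → l ≠ k → ∀ j,
        IsCyclicQuad i j l k ∨ IsCyclicQuad l j i k →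
        signedX j l = signedX j k * Ring.inverse (signedX i k) * signedX i l +
          signedX j i * Ring.inverse (signedX k i) * signedX k l := by
      intro i k l hik hil hlk j h
      have h1 := signedX_exchange_of_cyclic_or h
      have h2 := signedX_triangle hil hik hlk
      have hu1 := isUnit_signedX i k hik
      have hu2 := isUnit_signedX l i hil.symm
      have hu3 := isUnit_signedX i l hil
      generalize signedX (n := n) = m at *
      have h3 : Ring.inverse (m l i) * m l k * Ring.inverse (m i k) * m i l =
          -(Ring.inverse (m k i) * m k l) := by
        have := congrArg (Ring.inverse (m l i) * ·) h2
        simp only [mul_add, mul_zero] at this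
        rw [mul_assoc (m l i), Ring.inverse_mul_cancel_left _ _ hu2] at this
        rw [← eq_neg_iff_add_eq_zero.2 this]
        noncomm_ring
      rw [h1]
      simp only [add_mul]
      rw [Ring.mul_inverse_cancel_right _ _ hu1, Ring.inverse_mul_cancel_right _ _ hu3]
      have : m j i * Ring.inverse (m l i) * m l k * Ring.inverse (m i k) * m i l =
        m j i * (Ring.inverse (m l i) * m l k * Ring.inverse (m i k) * m i l) := by noncomm_ring
      rw [this, h3]
      noncomm_ring
    intro i k hik j l
    by_cases hji : j = i
    · subst hji
      rw [Ring.mul_inverse_cancel _ (isUnit_signedX _ _ hik), signedX_self]; simp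
    by_cases hjk : j = k
    · subst hjk
      rw [Ring.mul_inverse_cancel _ (isUnit_signedX _ _ hik.symm), signedX_self]; simp
    by_cases hli : l = i
    · subst hli
      rw [Ring.inverse_mul_cancel_right _ _ (isUnit_signedX _ _ hik.symm), signedX_self]; simp
    by_cases hlk : l = k
    · subst hlk
      rw [Ring.inverse_mul_cancel_right _ _ (isUnit_signedX _ _ hik), signedX_self]; simp
    by_cases hjl : j = l
    · subst hjl
      rw [signedX_triangle (Ne.symm hji) hik hjk, signedX_self]
    rcases cyclicQuad_cases (Ne.symm hji) hik (Ne.symm hli) hjk hjl (Ne.symm hlk) with h | h | h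
    · exact signedX_exchange_of_cyclic_or h
    · exact key i k l hik (Ne.symm hli) hlk j h
    · rw [key k i l hik.symm (Ne.symm hlk) hli j h, add_comm]

variable {R : Type*} [Ring R]

variable [Algebra ℚ R] {m : Fin n → Fin n → R}

/-- The values of the generators determined by a signed matrix. -/
noncomputable def genValue (m : Fin n → Fin n → R) : Gen n → R
  | .x i j _ => if i < j then m i j else -m i j
  | .xInv i j _ => if i < j then Ring.inverse (m i j) else -Ring.inverse (m i j)

theorem lift_genValue_rel (h : IsPolygon m) ⦃a b : FreeAlgebra ℚ (Gen n)⦄ (hab : Rel n a b) :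
    FreeAlgebra.lift ℚ (genValue m) a = FreeAlgebra.lift ℚ (genValue m) b := by
  cases hab with
  | mul_inv i j hij =>
    simp only [fx, fxInv, map_mul, map_one, FreeAlgebra.lift_ι_apply, genValue]
    split_ifs <;> simp [Ring.mul_inverse_cancel _ (h.isUnit i j hij)]
  | inv_mul i j hij =>
    simp only [fx, fxInv, map_mul, map_one, FreeAlgebra.lift_ι_apply, genValue]
    split_ifs <;> simp [Ring.inverse_mul_cancel _ (h.isUnit i j hij)]
  | triangle i j k hij hik hjk =>
    simp only [fx, fxInv, map_mul, FreeAlgebra.lift_ι_apply, genValue]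
    -- The triangle relation is the exchange relation for a diagonal entry, which is zero.
    have hx := h.exchange j k hjk i i
    rw [h.diag, eq_comm, add_eq_zero_iff_eq_neg] at hx
    rcases lt_or_gt_of_ne hij with h1 | h1 <;> rcases lt_or_gt_of_ne hik with h2 | h2 <;>
      rcases lt_or_gt_of_ne hjk with h3 | h3 <;> first | omega | skip
    all_goals simp [h1, h2, h3, h1.not_gt, h2.not_gt, h3.not_gt, hx]
  | exchange i j k l hcyc hij hik hil hjk hjl hkl =>
    simp only [fx, fxInv, map_mul, map_add, FreeAlgebra.lift_ι_apply, genValue]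
    have hx := h.exchange i k hik j l
    rcases hcyc with ⟨h1, h2, h3⟩ | ⟨h1, h2, h3⟩ | ⟨h1, h2, h3⟩ | ⟨h1, h2, h3⟩ <;>
    · have h4 := h1.trans h2
      have h5 := h2.trans h3
      have h6 := h4.trans h3
      simp [h1, h2, h3, h4, h5, h6, h1.not_gt, h2.not_gt, h3.not_gt, h4.not_gt, h5.not_gt,
        h6.not_gt, hx, add_comm]

/-- The representation of the noncommutative polygon determined by a signed matrix. -/
noncomputable def IsPolygon.lift (h : IsPolygon m) : PolygonAlgebra n →ₐ[ℚ] R :=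
  RingQuot.liftAlgHom ℚ ⟨FreeAlgebra.lift ℚ (genValue m), lift_genValue_rel h⟩

theorem IsPolygon.lift_mk (h : IsPolygon m) (a : FreeAlgebra ℚ (Gen n)) :
    h.lift (NCPolygon.mk n a) = FreeAlgebra.lift ℚ (genValue m) a :=
  RingQuot.liftAlgHom_mkAlgHom_apply ℚ _ _ _

theorem IsPolygon.lift_x (h : IsPolygon m) (i j : Fin n) (hij : i ≠ j) :
    h.lift (x i j hij) = if i < j then m i j else -m i j := by
  rw [x, h.lift_mk, fx, FreeAlgebra.lift_ι_apply, genValue]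

/-- Representations of the noncommutative polygon are determined by the images of the `x_{ij}`. -/
theorem algHom_ext_x {f g : PolygonAlgebra n →ₐ[ℚ] R} (h : ∀ i j hij, f (x i j hij) = g (x i j hij)) :
    f = g := by
  have hinv : ∀ i j hij, f (xInv i j hij) = g (xInv i j hij) := fun i j hij => by
    rw [← ringInverse_x, map_ringInverse f (isUnit_x i j hij), map_ringInverse g (isUnit_x i j hij),
      h]
  refine RingQuot.ringQuot_ext' ℚ f g (FreeAlgebra.hom_ext (funext fun s => ?_))
  cases s with
  | x i j hij => exact h i j hij
  | xInv i j hij => exact hinv i j hij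

end PolygonAlgebra
-- Extending values on the chords to a full matrix.
namespace Triangulation

variable {n : ℕ} (Δ : Triangulation n) {R : Type*} [Ring R]

/-- Signed invertible values on the chords of `Δ` that satisfy the triangle relations. -/
structure IsTriangleRep (τ : Fin n → Fin n → R) : Prop where
  isUnit (i j : Fin n) (h : (i, j) ∈ Δ.chords) : IsUnit (τ i j)
  triangle (c a b : Fin n) (h : Δ.Parents c a b) :
    τ c b * Ring.inverse (τ a b) * τ a c + τ c a * Ring.inverse (τ b a) * τ b c = 0

/-- The matrix `m` extends the values `τ` on the chords of `Δ` by the exchange relations for the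
triangles of `Δ`. -/
structure IsExtension (τ m : Fin n → Fin n → R) : Prop where
  diag (i : Fin n) : m i i = 0
  chord (i j : Fin n) (h : (i, j) ∈ Δ.chords) : m i j = τ i j
  row (c a b : Fin n) (h : Δ.Parents c a b) (l : Fin n) :
    m c l = τ c b * Ring.inverse (τ a b) * m a l + τ c a * Ring.inverse (τ b a) * m b l
  col (c a b : Fin n) (h : Δ.Parents c a b) (j : Fin n) :
    m j c = m j b * (Ring.inverse (τ a b) * τ a c) + m j a * (Ring.inverse (τ b a) * τ b c)

variable {Δ} {τ : Fin n → Fin n → R}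

/-- The matrix is `m j l = p j * q l` for row vectors `p j` and column vectors `q l` of length two,
constructed along the tree of triangles. -/
theorem IsTriangleRep.exists_isExtension (hn : 2 ≤ n) (hτ : Δ.IsTriangleRep τ) :
    ∃ m, Δ.IsExtension τ m := by
  set z : Fin n := ⟨0, by omega⟩ with hz
  set w : Fin n := ⟨n - 1, by omega⟩ with hw
  -- The base values of `p` and `q` are chosen so that the block of `m` on `{z, w}` has zero
  -- diagonal and off-diagonal entries `τ z w`, `τ w z`.
  set p : Fin n → R × R := Δ.treeRec (1, 0) (0, 1) fun c a b x y =>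
    (τ c b * Ring.inverse (τ a b)) • x + (τ c a * Ring.inverse (τ b a)) • y with hp
  set q : Fin n → R × R := Δ.treeRec (0, τ w z) (τ z w, 0) fun c a b x y =>
    (y.1 * (Ring.inverse (τ a b) * τ a c) + x.1 * (Ring.inverse (τ b a) * τ b c),
      y.2 * (Ring.inverse (τ a b) * τ a c) + x.2 * (Ring.inverse (τ b a) * τ b c)) with hq
  set m : Fin n → Fin n → R := fun j l => (p j).1 * (q l).1 + (p j).2 * (q l).2 with hm
  have hrow : ∀ c a b, Δ.Parents c a b → ∀ l,
      m c l = τ c b * Ring.inverse (τ a b) * m a l + τ c a * Ring.inverse (τ b a) * m b l := by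
    intro c a b h l
    simp only [hm]
    rw [hp, h.treeRec_eq]
    simp only [Prod.fst_add, Prod.snd_add, Prod.smul_fst, Prod.smul_snd, smul_eq_mul]
    noncomm_ring
  have hcol : ∀ c a b, Δ.Parents c a b → ∀ j,
      m j c = m j b * (Ring.inverse (τ a b) * τ a c) +
        m j a * (Ring.inverse (τ b a) * τ b c) := by
    intro c a b h j
    simp only [hm]
    rw [hq, h.treeRec_eq]
    noncomm_ring
  have hz0 : ∀ c : Fin n, c.val = 0 → c = z := fun c hc => Fin.ext hc
  have hw0 : ∀ c : Fin n, c.val + 1 = n → c = w := fun c hc => Fin.ext (by simp [hw]; omega)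
  have hpz : p z = (1, 0) := treeRec_zero _ _ _ rfl
  have hqz : q z = (0, τ w z) := treeRec_zero _ _ _ rfl
  have hpw : p w = (0, 1) := treeRec_last _ _ _ (by simp [hw]; omega) (by simp [hw]; omega)
  have hqw : q w = (τ z w, 0) := treeRec_last _ _ _ (by simp [hw]; omega) (by simp [hw]; omega)
  have hmzw : m z w = τ z w := by simp [hm, hpz, hqw]
  have hmwz : m w z = τ w z := by simp [hm, hpw, hqz]
  have hmzz : m z z = 0 := by simp [hm, hpz, hqz]
  have hmww : m w w = 0 := by simp [hm, hpw, hqw]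
  have hchord : ∀ i j : Fin n, i < j → (i, j) ∈ Δ.chords →
      (∀ b, Δ.Parents j i b → m i j = τ i j ∧ m j i = τ j i) →
      (∀ a, Δ.Parents i a j → m i j = τ i j ∧ m j i = τ j i) →
      m i j = τ i j ∧ m j i = τ j i := by
    intro i j hij h h1 h2
    rcases chord_cases hij h with ⟨h3, h4⟩ | ⟨b, h3⟩ | ⟨a, h3⟩
    · rw [hz0 i h3, hw0 j h4]; exact ⟨hmzw, hmwz⟩
    · exact h1 b h3
    · exact h2 a h3
  -- The base `(a, b)` is the root side or joins one of its ends to a parent of that end, so its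
  -- value is known by induction. Then `m c c = 0` is exactly the triangle relation for `a, c, b`.
  have key : ∀ c, m c c = 0 ∧ ∀ a b, Δ.Parents c a b →
      (m a c = τ a c ∧ m c a = τ c a) ∧ (m c b = τ c b ∧ m b c = τ b c) := by
    refine Δ.tree_induction ?_ ?_ ?_
    · intro c hc
      refine ⟨by rw [hz0 c hc, hmzz], fun a b h => ?_⟩
      have := h.lt_left
      omega
    · intro c hc
      refine ⟨by rw [hw0 c hc, hmww], fun a b h => ?_⟩
      have := h.lt_right
      omega
    · intro c a b h iha ihb
      have hab := hchord a b (h.lt_left.trans h.lt_right) h.base_mem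
        (fun b' h' => (ihb.2 a b' h').1) (fun a' h' => (iha.2 a' b h').2)
      have hu := hτ.isUnit _ _ h.base_mem
      have hu' := hτ.isUnit _ _ (Δ.swap_mem h.base_mem)
      have h1 : m a c = τ a c := by
        rw [hcol c a b h a, hab.1, iha.1, zero_mul, add_zero, Ring.mul_inverse_cancel_left _ _ hu]
      have h2 : m b c = τ b c := by
        rw [hcol c a b h b, hab.2, ihb.1, zero_mul, zero_add, Ring.mul_inverse_cancel_left _ _ hu']
      have h3 : m c a = τ c a := by
        rw [hrow c a b h a, hab.2, iha.1, mul_zero, zero_add,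
          Ring.inverse_mul_cancel_right _ _ hu']
      have h4 : m c b = τ c b := by
        rw [hrow c a b h b, hab.1, ihb.1, mul_zero, add_zero,
          Ring.inverse_mul_cancel_right _ _ hu]
      refine ⟨by rw [hrow c a b h c, h1, h2, hτ.triangle c a b h], fun a' b' h' => ?_⟩
      obtain ⟨rfl, rfl⟩ := h.unique h'
      exact ⟨⟨h1, h3⟩, h4, h2⟩
  have hboth : ∀ i j : Fin n, i < j → (i, j) ∈ Δ.chords → m i j = τ i j ∧ m j i = τ j i :=
    fun i j hij h => hchord i j hij h (fun b h' => ((key j).2 i b h').1)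
      (fun a h' => ((key i).2 a j h').2)
  refine ⟨m, fun c => (key c).1, fun i j h => ?_, hrow, hcol⟩
  rcases lt_or_gt_of_ne (Δ.ne h) with hij | hij
  · exact (hboth i j hij h).1
  · exact (hboth j i hij (Δ.swap_mem h)).2

/-- If all rows of `m` are determined by the exchange relations for the triangles of `Δ`, then `m`
satisfies all exchange relations. -/
theorem isPolygon_of_row (hn : 2 ≤ n) {τ m : Fin n → Fin n → R} (hd : ∀ i, m i i = 0)
    (hu : ∀ i j, i ≠ j → IsUnit (m i j))
    (hrow : ∀ c a b, Δ.Parents c a b → ∀ l,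
      m c l = τ c b * Ring.inverse (τ a b) * m a l + τ c a * Ring.inverse (τ b a) * m b l) :
    IsPolygon m := by
  have hzw : (⟨0, by omega⟩ : Fin n) ≠ ⟨n - 1, by omega⟩ := by
    intro h; rw [Fin.mk.injEq] at h; omega
  refine RowsSpanned.isPolygon hd hu hzw ?_
  refine Δ.tree_induction ?_ ?_ ?_
  · intro c hc
    have hc' : c = ⟨0, by omega⟩ := Fin.ext hc
    exact ⟨1, 0, fun l => by simp [hc']⟩
  · intro c hc
    have hc' : c = ⟨n - 1, by omega⟩ := Fin.ext (by simp only; omega)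
    exact ⟨0, 1, fun l => by simp [hc']⟩
  · rintro c a b h ⟨α, β, ha⟩ ⟨γ, δ, hb⟩
    refine ⟨τ c b * Ring.inverse (τ a b) * α + τ c a * Ring.inverse (τ b a) * γ,
      τ c b * Ring.inverse (τ a b) * β + τ c a * Ring.inverse (τ b a) * δ, fun l => ?_⟩
    rw [hrow c a b h l, ha, hb]
    noncomm_ring

end Triangulation

/-! ### Laurent series with invertible leading coefficient. -/

section LeadingTerm

open HahnSeries

variable {S : Type*} [Ring S]

theorem single_one_mul_comm (d : ℤ) (f : HahnSeries ℤ S) :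
    single d (1 : S) * f = f * single d (1 : S) := by
  ext e
  rw [coeff_single_mul, coeff_mul_single, one_mul, mul_one]

/-- `f` is a Laurent series of order `d` with invertible leading coefficient. -/
def HasUnitLead (d : ℤ) (f : HahnSeries ℤ S) : Prop :=
  ∃ u : (PowerSeries S)ˣ, f = single d (1 : S) * ofPowerSeries ℤ S u

theorem HasUnitLead.mul {d e : ℤ} {f g : HahnSeries ℤ S} (hf : HasUnitLead d f)
    (hg : HasUnitLead e g) : HasUnitLead (d + e) (f * g) := by
  obtain ⟨u, rfl⟩ := hf
  obtain ⟨v, rfl⟩ := hg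
  refine ⟨u * v, ?_⟩
  rw [Units.val_mul, map_mul, ← mul_one (1 : S), ← single_mul_single, mul_one]
  simp only [mul_assoc]
  rw [← mul_assoc _ (single e 1), ← single_one_mul_comm, mul_assoc]

theorem HasUnitLead.neg {d : ℤ} {f : HahnSeries ℤ S} (hf : HasUnitLead d f) :
    HasUnitLead d (-f) := by
  obtain ⟨u, rfl⟩ := hf
  exact ⟨-u, by simp⟩

theorem single_mul_single_neg (d : ℤ) : single d (1 : S) * single (-d) (1 : S) = 1 := by
  rw [single_mul_single, add_neg_cancel, mul_one]; rfl

theorem HasUnitLead.mul_inv {d : ℤ} (u : (PowerSeries S)ˣ) :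
    (single d (1 : S) * ofPowerSeries ℤ S u) * (single (-d) (1 : S) * ofPowerSeries ℤ S ↑u⁻¹) =
      1 := by
  rw [single_one_mul_comm, mul_assoc, ← mul_assoc (single d 1), single_mul_single_neg, one_mul,
    ← map_mul, Units.mul_inv, map_one]

theorem HasUnitLead.inv_mul {d : ℤ} (u : (PowerSeries S)ˣ) :
    (single (-d) (1 : S) * ofPowerSeries ℤ S ↑u⁻¹) * (single d (1 : S) * ofPowerSeries ℤ S u) =
      1 := by
  simpa using HasUnitLead.mul_inv (d := -d) u⁻¹

theorem HasUnitLead.isUnit {d : ℤ} {f : HahnSeries ℤ S} (hf : HasUnitLead d f) : IsUnit f := by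
  obtain ⟨u, rfl⟩ := hf
  exact ⟨⟨_, _, HasUnitLead.mul_inv u, HasUnitLead.inv_mul u⟩, rfl⟩

theorem HasUnitLead.ringInverse {d : ℤ} {f : HahnSeries ℤ S} (hf : HasUnitLead d f) :
    HasUnitLead (-d) (Ring.inverse f) := by
  obtain ⟨u, rfl⟩ := hf
  exact ⟨u⁻¹, ringInverse_eq (HasUnitLead.mul_inv u) (HasUnitLead.inv_mul u)⟩

theorem isUnit_powerSeries {f : PowerSeries S} (hf : IsUnit (PowerSeries.constantCoeff f)) :
    IsUnit f := by
  obtain ⟨u, hu⟩ := hf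
  exact ⟨⟨f, PowerSeries.invOfUnit f u, PowerSeries.mul_invOfUnit f u hu.symm,
    PowerSeries.invOfUnit_mul f u hu.symm⟩, rfl⟩

/-- Strictness of `d < e` is essential: after factoring out the power `d`, the second summand has
zero constant coefficient, so no cancellation can occur. -/
theorem HasUnitLead.add {d e : ℤ} {f g : HahnSeries ℤ S} (hf : HasUnitLead d f)
    (hg : HasUnitLead e g) (h : d < e) : HasUnitLead d (f + g) := by
  obtain ⟨u, rfl⟩ := hf
  obtain ⟨v, rfl⟩ := hg
  obtain ⟨k, rfl⟩ := Int.le.dest h.le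
  have hk : k ≠ 0 := by omega
  have hu : IsUnit ((u : PowerSeries S) + PowerSeries.X ^ k * (v : PowerSeries S)) := by
    refine isUnit_powerSeries ?_
    rw [map_add, map_mul, map_pow, PowerSeries.constantCoeff_X, zero_pow hk, zero_mul, add_zero]
    exact u.isUnit.map _
  refine ⟨hu.unit, ?_⟩
  have hs : single (d + (k : ℤ)) (1 : S) =
      single d (1 : S) * ofPowerSeries ℤ S (PowerSeries.X ^ k) := by
    rw [ofPowerSeries_X_pow, single_mul_single, mul_one]
  rw [IsUnit.unit_spec, map_add, map_mul, hs, mul_add, mul_assoc]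

theorem hasUnitLead_single (d : ℤ) (u : Sˣ) : HasUnitLead d (single d (u : S)) := by
  refine ⟨Units.map (PowerSeries.C (R := S)).toMonoidHom u, ?_⟩
  simp

end LeadingTerm

/-! ### Orders of the entries of an extension. -/

namespace Triangulation

variable {n : ℕ} {Δ : Triangulation n} {S : Type*} [Ring S] {τ m : Fin n → Fin n → HahnSeries ℤ S}

/-- Expand the row or column of a vertex along its parents. Of the two terms, one has order `min i
j` and the other, unless it vanishes, strictly larger order. -/
theorem IsExtension.hasUnitLead (hm : Δ.IsExtension τ m)
    (hτ : ∀ i j, (i, j) ∈ Δ.chords → HasUnitLead ((min i j : Fin n) : ℕ) (τ i j))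
    (i j : Fin n) (hij : i ≠ j) : HasUnitLead ((min i j : Fin n) : ℕ) (m i j) := by
  induction hN : Δ.depth i + Δ.depth j using Nat.strong_induction_on generalizing i j with
  | _ N IH =>
  subst hN
  have hτlt : ∀ i j : Fin n, i < j → (i, j) ∈ Δ.chords →
      HasUnitLead (i : ℕ) (τ i j) ∧ HasUnitLead (i : ℕ) (τ j i) := fun i j h h' => by
    have h1 := hτ i j h'
    have h2 := hτ j i (Δ.swap_mem h')
    rw [min_eq_left h.le] at h1
    rw [min_eq_right h.le] at h2
    exact ⟨h1, h2⟩
  have hlt : ∀ i' j' : Fin n, i' < j' → Δ.depth i' + Δ.depth j' < Δ.depth i + Δ.depth j →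
      HasUnitLead (i' : ℕ) (m i' j') := fun i' j' h h' => by
    simpa only [min_eq_left h.le] using IH _ h' i' j' h.ne rfl
  have hgt : ∀ i' j' : Fin n, j' < i' → Δ.depth i' + Δ.depth j' < Δ.depth i + Δ.depth j →
      HasUnitLead (j' : ℕ) (m i' j') := fun i' j' h h' => by
    simpa only [min_eq_right h.le] using IH _ h' i' j' h.ne' rfl
  -- The vertex to expand is chosen so that neither parent lies strictly beyond the other index;
  -- this keeps the minima in the expanded entries under control.
  have hcases : ∀ i j : Fin n, i < j → (i, j) ∈ Δ.chords ∨
      (∃ a b, Δ.Parents j a b ∧ i ≤ a) ∨ ∃ a b, Δ.Parents i a b ∧ b ≤ j := by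
    intro i j h
    by_cases hi : i.val = 0
    · by_cases hj : j.val + 1 = n
      · exact Or.inl (Δ.mem_root hi hj h.ne)
      · obtain ⟨a, b, hp⟩ := Δ.exists_parents (c := j) (by omega) hj
        exact Or.inr (Or.inl ⟨a, b, hp, by omega⟩)
    · obtain ⟨a, b, hp⟩ := Δ.exists_parents (c := i) hi (by omega)
      by_cases hb : b ≤ j
      · exact Or.inr (Or.inr ⟨a, b, hp, hb⟩)
      · obtain ⟨a', b', hp'⟩ := Δ.exists_parents (c := j) (by omega) (by omega)
        refine Or.inr (Or.inl ⟨a', b', hp', ?_⟩)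
        by_contra ha
        refine Δ.not_crosses hp'.left_mem hp.right_mem ?_
        simp only [IsCyclicQuad]
        omega
  rcases lt_or_gt_of_ne hij with h | h
  · rw [min_eq_left h.le]
    rcases hcases i j h with hc | ⟨a, b, hp, ha⟩ | ⟨a, b, hp, hb⟩
    · rw [hm.chord i j hc]
      exact (hτlt i j h hc).1
    · have h1 := hτlt a b (hp.lt_left.trans hp.lt_right) hp.base_mem
      have h2 := hτlt a j hp.lt_left hp.left_mem
      have h3 := hτlt j b hp.lt_right hp.right_mem
      have := hp.depth_left_lt
      have := hp.depth_right_lt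
      have h4 := hlt i b (h.trans hp.lt_right) (by omega)
      rw [hm.col j a b hp i]
      have h5 := h4.mul (h1.1.ringInverse.mul h2.1)
      rcases ha.eq_or_lt with rfl | ha
      · rw [hm.diag, zero_mul, add_zero]
        convert h5 using 1; omega
      -- This term has order `i - a + j`, which exceeds `i` since `a < j`.
      · have h6 := (hlt i a ha (by omega)).mul (h1.2.ringInverse.mul h3.2)
        have := hp.lt_left
        convert h5.add h6 (by omega) using 1; omega
    · have h1 := hτlt a b (hp.lt_left.trans hp.lt_right) hp.base_mem
      have h2 := hτlt a i hp.lt_left hp.left_mem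
      have h3 := hτlt i b hp.lt_right hp.right_mem
      have := hp.depth_left_lt
      have := hp.depth_right_lt
      have h4 := hlt a j (hp.lt_left.trans h) (by omega)
      rw [hm.row i a b hp j]
      have h5 := (h3.1.mul h1.1.ringInverse).mul h4
      rcases hb.eq_or_lt with rfl | hb
      · rw [hm.diag, mul_zero, add_zero]
        convert h5 using 1; omega
      · have h6 := (h2.2.mul h1.2.ringInverse).mul (hlt b j hb (by omega))
        have := hp.lt_right
        convert h5.add h6 (by omega) using 1; omega
  · rw [min_eq_right h.le]
    rcases hcases j i h with hc | ⟨a, b, hp, ha⟩ | ⟨a, b, hp, hb⟩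
    · rw [hm.chord i j (Δ.swap_mem hc)]
      exact (hτlt j i h hc).2
    · have h1 := hτlt a b (hp.lt_left.trans hp.lt_right) hp.base_mem
      have h2 := hτlt a i hp.lt_left hp.left_mem
      have h3 := hτlt i b hp.lt_right hp.right_mem
      have := hp.depth_left_lt
      have := hp.depth_right_lt
      have h4 := hgt b j (h.trans hp.lt_right) (by omega)
      -- Below the diagonal the dominant term is the other summand, hence the swap.
      rw [hm.row i a b hp j, add_comm]
      have h5 := (h2.2.mul h1.2.ringInverse).mul h4
      rcases ha.eq_or_lt with rfl | ha
      · rw [hm.diag, mul_zero, add_zero]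
        convert h5 using 1; omega
      · have h6 := (h3.1.mul h1.1.ringInverse).mul (hgt a j ha (by omega))
        have := hp.lt_left
        convert h5.add h6 (by omega) using 1; omega
    · have h1 := hτlt a b (hp.lt_left.trans hp.lt_right) hp.base_mem
      have h2 := hτlt a j hp.lt_left hp.left_mem
      have h3 := hτlt j b hp.lt_right hp.right_mem
      have := hp.depth_left_lt
      have := hp.depth_right_lt
      have h4 := hgt i a (hp.lt_left.trans h) (by omega)
      rw [hm.col j a b hp i, add_comm]
      have h5 := h4.mul (h1.2.ringInverse.mul h3.2)
      rcases hb.eq_or_lt with rfl | hb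
      · rw [hm.diag, zero_mul, add_zero]
        convert h5 using 1; omega
      · have h6 := (hgt i b hb (by omega)).mul (h1.1.ringInverse.mul h2.1)
        have := hp.lt_right
        convert h5.add h6 (by omega) using 1; omega

end Triangulation
-- Injectivity of `iHom`.
namespace Triangulation

variable {n : ℕ} (Δ : Triangulation n)

section GroupAlgebra

open HahnSeries

theorem triangleGroup_rel {i j k : Fin n} (hij : (i, j) ∈ Δ.chords) (hjk : (j, k) ∈ Δ.chords)
    (hki : (k, i) ∈ Δ.chords) :
    (PresentedGroup.of ⟨(i, j), hij⟩ * (PresentedGroup.of ⟨(k, j), Δ.swap_mem hjk⟩)⁻¹ *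
      PresentedGroup.of ⟨(k, i), hki⟩ : Δ.TriangleGroup) =
    PresentedGroup.of ⟨(i, k), Δ.swap_mem hki⟩ * (PresentedGroup.of ⟨(j, k), hjk⟩)⁻¹ *
      PresentedGroup.of ⟨(j, i), Δ.swap_mem hij⟩ := by
  rw [← mul_inv_eq_one]
  exact PresentedGroup.one_of_mem ⟨i, j, k, hij, hjk, hki, rfl⟩

/-- The grading of the triangle group in which `t_{ij}` has degree `min i j`. -/
noncomputable def degree : Δ.TriangleGroup →* Multiplicative ℤ :=
  PresentedGroup.toGroup
    (f := fun p : Δ.chords => Multiplicative.ofAdd (((min p.1.1 p.1.2 : Fin n) : ℕ) : ℤ)) <| by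
    rintro r ⟨i, j, k, hij, hjk, hki, rfl⟩
    simp only [map_mul, map_inv, FreeGroup.lift_apply_of]
    -- Reversing all chords turns one side of a triangle relation into the other up to order, and
    -- `min` is symmetric.
    rw [mul_inv_eq_one, min_comm i j, min_comm k j, min_comm k i]
    rw [mul_comm, mul_comm _ (Multiplicative.ofAdd (((min j i : Fin n) : ℕ) : ℤ)), mul_left_comm]

theorem degree_of (p : Δ.chords) :
    Δ.degree (PresentedGroup.of p) =
      Multiplicative.ofAdd (((min p.1.1 p.1.2 : Fin n) : ℕ) : ℤ) :=
  PresentedGroup.toGroup.of _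

/-- The homogeneous embedding of the triangle group into Laurent series over its group algebra. -/
noncomputable def laurentHom : Δ.TriangleGroup →* HahnSeries ℤ (MonoidAlgebra ℚ Δ.TriangleGroup) where
  toFun g := single (Δ.degree g).toAdd (MonoidAlgebra.of ℚ _ g)
  map_one' := by simp only [map_one, toAdd_one]; rfl
  map_mul' g h := by rw [single_mul_single, map_mul Δ.degree, map_mul (MonoidAlgebra.of ℚ _), toAdd_mul]

theorem laurentHom_apply (g : Δ.TriangleGroup) :
    Δ.laurentHom g = single (Δ.degree g).toAdd (MonoidAlgebra.of ℚ _ g) := rfl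

theorem hasUnitLead_laurentHom (g : Δ.TriangleGroup) :
    HasUnitLead (Δ.degree g).toAdd (Δ.laurentHom g) :=
  hasUnitLead_single _ (Units.map (MonoidAlgebra.of ℚ Δ.TriangleGroup) (toUnits g))

/-- The coefficient of `g` in an element can be read off its image, in the Laurent coefficient of
index `degree g`. -/
theorem lift_laurentHom_injective :
    Function.Injective (MonoidAlgebra.lift ℚ (HahnSeries ℤ (MonoidAlgebra ℚ Δ.TriangleGroup))
      Δ.TriangleGroup Δ.laurentHom) := by
  have key : ∀ (a : MonoidAlgebra ℚ Δ.TriangleGroup) (g : Δ.TriangleGroup),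
      (((MonoidAlgebra.lift ℚ (HahnSeries ℤ (MonoidAlgebra ℚ Δ.TriangleGroup))
        Δ.TriangleGroup Δ.laurentHom) a).coeff (Δ.degree g).toAdd).coeff g = a.coeff g := by
    intro a g
    induction a using MonoidAlgebra.induction_linear with
    | zero => simp
    | add a b ha hb => simp [ha, hb]
    | single h r =>
      rw [MonoidAlgebra.lift_single, laurentHom_apply]
      by_cases hgh : h = g
      · subst hgh
        simp
      · by_cases hd : (Δ.degree g).toAdd = (Δ.degree h).toAdd
        · simp [hd, hgh]
        · simp [coeff_single_of_ne hd, hgh]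
  intro a b hab
  refine MonoidAlgebra.ext (Finsupp.ext fun g => ?_)
  rw [← key a g, ← key b g, hab]

open Classical in
/-- The signed images of the generators `t_{ij}` under a representation of the triangle group. -/
noncomputable def signedValue {R : Type*} [Ring R] (φ : Δ.TriangleGroup →* R) (i j : Fin n) : R :=
  if h : (i, j) ∈ Δ.chords then
    if i < j then φ (PresentedGroup.of ⟨(i, j), h⟩) else -φ (PresentedGroup.of ⟨(i, j), h⟩)
  else 0

variable {Δ}

section SignedValue

variable {R : Type*} [Ring R] (φ : Δ.TriangleGroup →* R)

theorem signedValue_of_lt {i j : Fin n} (h : (i, j) ∈ Δ.chords) (hij : i < j) :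
    Δ.signedValue φ i j = φ (PresentedGroup.of ⟨(i, j), h⟩) := by
  rw [signedValue, dif_pos h, if_pos hij]

theorem signedValue_of_gt {i j : Fin n} (h : (i, j) ∈ Δ.chords) (hij : j < i) :
    Δ.signedValue φ i j = -φ (PresentedGroup.of ⟨(i, j), h⟩) := by
  rw [signedValue, dif_pos h, if_neg hij.not_gt]

theorem isTriangleRep_signedValue : Δ.IsTriangleRep (Δ.signedValue φ) where
  isUnit i j h := by
    have hu : IsUnit (φ (PresentedGroup.of ⟨(i, j), h⟩)) := (Group.isUnit _).map φ
    rcases lt_or_gt_of_ne (Δ.ne h) with hij | hij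
    · rw [signedValue_of_lt φ h hij]; exact hu
    · rw [signedValue_of_gt φ h hij]; exact hu.neg
  triangle c a b h := by
    have hinv : ∀ g, Ring.inverse (φ g) = φ g⁻¹ := fun g =>
      ringInverse_eq (by rw [← map_mul, mul_inv_cancel, map_one])
        (by rw [← map_mul, inv_mul_cancel, map_one])
    have hab := h.lt_left.trans h.lt_right
    rw [signedValue_of_lt φ h.right_mem h.lt_right, signedValue_of_lt φ h.base_mem hab,
      signedValue_of_lt φ h.left_mem h.lt_left,
      signedValue_of_gt φ (Δ.swap_mem h.right_mem) h.lt_right,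
      signedValue_of_gt φ (Δ.swap_mem h.base_mem) hab,
      signedValue_of_gt φ (Δ.swap_mem h.left_mem) h.lt_left]
    simp only [ringInverse_neg, hinv, neg_mul, mul_neg, neg_neg, ← map_mul]
    rw [Δ.triangleGroup_rel h.right_mem (Δ.swap_mem h.base_mem) h.left_mem, add_neg_cancel]

end SignedValue

theorem hasUnitLead_signedValue (i j : Fin n) (h : (i, j) ∈ Δ.chords) :
    HasUnitLead ((min i j : Fin n) : ℕ) (Δ.signedValue Δ.laurentHom i j) := by
  have h1 := Δ.hasUnitLead_laurentHom (PresentedGroup.of ⟨(i, j), h⟩)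
  rw [degree_of, toAdd_ofAdd] at h1
  rcases lt_or_gt_of_ne (Δ.ne h) with hij | hij
  · rw [signedValue_of_lt _ h hij]; exact h1
  · rw [signedValue_of_gt _ h hij]; exact h1.neg

/-- The extension of `laurentHom` represents the whole polygon algebra; composed with `iHom` it
gives back the injective linear extension of `laurentHom`. -/
theorem iHom_injective (hn : 2 ≤ n) : Function.Injective Δ.iHom := by
  obtain ⟨m, hm⟩ := isTriangleRep_signedValue Δ.laurentHom |>.exists_isExtension hn
  have hp : IsPolygon m := isPolygon_of_row hn hm.diag
    (fun i j h => (hm.hasUnitLead hasUnitLead_signedValue i j h).isUnit) hm.row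
  have hcomp : (hp.lift.comp Δ.subalgebra.val).comp Δ.iHom =
      MonoidAlgebra.lift ℚ _ _ Δ.laurentHom := by
    rw [MonoidAlgebra.lift_unique' ((hp.lift.comp Δ.subalgebra.val).comp Δ.iHom)]
    refine congrArg _ (MonoidHom.eq_of_eqOn_dense (PresentedGroup.closure_range_of _) ?_)
    rintro _ ⟨⟨⟨i, j⟩, h⟩, rfl⟩
    have h1 : (hp.lift.comp Δ.subalgebra.val).comp Δ.iHom
        (MonoidAlgebra.of ℚ _ (PresentedGroup.of ⟨(i, j), h⟩)) =
        Δ.laurentHom (PresentedGroup.of ⟨(i, j), h⟩) := by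
      rw [AlgHom.comp_apply, AlgHom.comp_apply, Subalgebra.coe_val, Δ.iHom_of h, hp.lift_x,
        hm.chord i j h]
      rcases lt_or_gt_of_ne (Δ.ne h) with hij | hij
      · rw [if_pos hij, signedValue_of_lt _ h hij]
      · rw [if_neg hij.not_gt, signedValue_of_gt _ h hij, neg_neg]
    exact h1
  have hinj := Δ.lift_laurentHom_injective
  rw [← hcomp] at hinj
  exact fun a b hab => hinj (congrArg (hp.lift.comp Δ.subalgebra.val) hab)

end GroupAlgebra

/-! ### Surjectivity of `iHom`. -/

theorem _root_.NCPolygon.IsPolygon.isExtension {Δ : Triangulation n} {R : Type*} [Ring R]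
    {m : Fin n → Fin n → R} (hm : IsPolygon m) : Δ.IsExtension m m where
  diag := hm.diag
  chord _ _ _ := rfl
  row c a b h l := hm.exchange a b (h.lt_left.trans h.lt_right).ne c l
  col c a b h j := by
    rw [hm.exchange a b (h.lt_left.trans h.lt_right).ne j c]
    simp only [mul_assoc]

variable {Δ}

/-- The entries of an extension lie in any subring that contains the values on the chords and
their inverses. -/
theorem IsExtension.mem {R : Type*} [Ring R] {τ m : Fin n → Fin n → R}
    (hm : Δ.IsExtension τ m) {A : Subring R} (h1 : ∀ i j, (i, j) ∈ Δ.chords → τ i j ∈ A)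
    (h2 : ∀ i j, (i, j) ∈ Δ.chords → Ring.inverse (τ i j) ∈ A) (j l : Fin n) : m j l ∈ A := by
  have hroot : ∀ j l : Fin n, (j.val = 0 ∨ j.val + 1 = n) → (l.val = 0 ∨ l.val + 1 = n) →
      m j l ∈ A := by
    intro j l hj hl
    by_cases hjl : j = l
    · rw [hjl, hm.diag]; exact A.zero_mem
    · have hc : (j, l) ∈ Δ.chords := by
        by_cases hj0 : j.val = 0
        · exact Δ.mem_root hj0 (by omega) hjl
        · exact Δ.swap_mem (Δ.mem_root (by omega) (by omega) (Ne.symm hjl))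
      rw [hm.chord j l hc]
      exact h1 j l hc
  -- Column expansions fill the two extreme rows from the root block; row expansions then reach all
  -- other rows.
  have hcol : ∀ j : Fin n, (j.val = 0 ∨ j.val + 1 = n) → ∀ l, m j l ∈ A := by
    intro j hj
    refine Δ.tree_induction (fun c hc => hroot j c hj (Or.inl hc))
      (fun c hc => hroot j c hj (Or.inr hc)) fun c a b h ha hb => ?_
    rw [hm.col c a b h j]
    exact A.add_mem (A.mul_mem hb (A.mul_mem (h2 _ _ h.base_mem) (h1 _ _ h.left_mem)))
      (A.mul_mem ha (A.mul_mem (h2 _ _ (Δ.swap_mem h.base_mem))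
        (h1 _ _ (Δ.swap_mem h.right_mem))))
  refine Δ.tree_induction (P := fun j => m j l ∈ A) (fun c hc => hcol c (Or.inl hc) l)
    (fun c hc => hcol c (Or.inr hc) l) (fun c a b h ha hb => ?_) j
  rw [hm.row c a b h l]
  exact A.add_mem (A.mul_mem (A.mul_mem (h1 _ _ h.right_mem) (h2 _ _ h.base_mem)) ha)
    (A.mul_mem (A.mul_mem (h1 _ _ (Δ.swap_mem h.left_mem)) (h2 _ _ (Δ.swap_mem h.base_mem))) hb)

/-- The range contains the chord generators and their inverses, hence, by the tree expansions, every
`x i j`. -/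
theorem iHom_surjective : Function.Surjective Δ.iHom := by
  set A : Subalgebra ℚ (PolygonAlgebra n) := (Δ.subalgebra.val.comp Δ.iHom).range with hA
  have hx : ∀ i j (h : (i, j) ∈ Δ.chords), x i j (Δ.ne h) ∈ A := fun i j h =>
    ⟨MonoidAlgebra.of ℚ _ (PresentedGroup.of ⟨(i, j), h⟩), Δ.iHom_of h⟩
  have hxInv : ∀ i j (h : (i, j) ∈ Δ.chords), xInv i j (Δ.ne h) ∈ A := fun i j h => by
    refine ⟨MonoidAlgebra.of ℚ _ (PresentedGroup.of ⟨(i, j), h⟩)⁻¹, ?_⟩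
    rw [← ringInverse_x]
    refine (ringInverse_eq ?_ ?_).symm
    · rw [← Δ.iHom_of h]
      change ((Δ.subalgebra.val.comp Δ.iHom) _ * (Δ.subalgebra.val.comp Δ.iHom) _) = 1
      rw [← map_mul, ← map_mul, mul_inv_cancel, map_one, map_one]
    · rw [← Δ.iHom_of h]
      change ((Δ.subalgebra.val.comp Δ.iHom) _ * (Δ.subalgebra.val.comp Δ.iHom) _) = 1
      rw [← map_mul, ← map_mul, inv_mul_cancel, map_one, map_one]
  have hs : ∀ i j : Fin n, signedX i j ∈ A := by
    refine isPolygon_signedX.isExtension (Δ := Δ) |>.mem (A := A.toSubring) ?_ ?_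
    · intro i j h
      rcases lt_or_gt_of_ne (Δ.ne h) with hij | hij
      · rw [signedX_of_lt hij]; exact hx i j h
      · rw [signedX_of_gt hij]; exact A.toSubring.neg_mem (hx i j h)
    · intro i j h
      rcases lt_or_gt_of_ne (Δ.ne h) with hij | hij
      · rw [signedX_of_lt hij, ringInverse_x]; exact hxInv i j h
      · rw [signedX_of_gt hij, ringInverse_neg, ringInverse_x]
        exact A.toSubring.neg_mem (hxInv i j h)
  have hle : Δ.subalgebra ≤ A := by
    refine Algebra.adjoin_le ?_
    rintro a (⟨i, j, h, rfl⟩ | ⟨i, j, h, rfl⟩)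
    · rcases lt_or_gt_of_ne h with hij | hij
      · rw [← signedX_of_lt hij]; exact hs i j
      · rw [← neg_neg (x i j h), ← signedX_of_gt hij]
        exact A.toSubring.neg_mem (hs i j)
    · exact hxInv i j h
  intro a
  obtain ⟨b, hb⟩ := hle a.2
  exact ⟨b, Subtype.ext hb⟩

/-! ### The universal localization. -/

variable (Δ)

theorem x_mem (i j : Fin n) (h : i ≠ j) : x i j h ∈ Δ.subalgebra :=
  Algebra.subset_adjoin (Or.inl ⟨i, j, h, rfl⟩)

theorem signedX_mem (i j : Fin n) : signedX i j ∈ Δ.subalgebra := by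
  unfold signedX
  split_ifs with h h'
  · exact Δ.subalgebra.zero_mem
  · exact Δ.x_mem i j h
  · exact Δ.subalgebra.neg_mem (Δ.x_mem i j h)

theorem isUnit_signedX_subalgebra {i j : Fin n} (h : (i, j) ∈ Δ.chords) :
    IsUnit (⟨signedX i j, Δ.signedX_mem i j⟩ : Δ.subalgebra) := by
  rcases lt_or_gt_of_ne (Δ.ne h) with hij | hij
  · convert (Δ.xUnit ⟨(i, j), h⟩).isUnit using 1
    exact Subtype.ext (signedX_of_lt hij)
  · convert (Δ.xUnit ⟨(i, j), h⟩).isUnit.neg using 1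
    exact Subtype.ext (signedX_of_gt hij)

/-- Only chords of `Δ` are inverted, so the relation already lives in `Δ.subalgebra` and is
preserved by every ring homomorphism out of it. -/
theorem signedX_subalgebra_row {c a b : Fin n} (h : Δ.Parents c a b) (l : Fin n) :
    (⟨signedX c l, Δ.signedX_mem c l⟩ : Δ.subalgebra) =
      ⟨signedX c b, Δ.signedX_mem c b⟩ * Ring.inverse ⟨signedX a b, Δ.signedX_mem a b⟩ *
        ⟨signedX a l, Δ.signedX_mem a l⟩ +
      ⟨signedX c a, Δ.signedX_mem c a⟩ * Ring.inverse ⟨signedX b a, Δ.signedX_mem b a⟩ *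
        ⟨signedX b l, Δ.signedX_mem b l⟩ := by
  have h1 := map_ringInverse Δ.subalgebra.val (Δ.isUnit_signedX_subalgebra h.base_mem)
  have h2 := map_ringInverse Δ.subalgebra.val
    (Δ.isUnit_signedX_subalgebra (Δ.swap_mem h.base_mem))
  rw [Subalgebra.coe_val] at h1 h2
  refine Subtype.ext ?_
  simp only [Subalgebra.coe_add, Subalgebra.coe_mul, h1, h2]
  exact isPolygon_signedX.exchange a b (h.lt_left.trans h.lt_right).ne c l

end Triangulation

/-- The image of `ℚ` under a ring homomorphism is central. -/
theorem ringHom_rat_commute {R : Type*} [Ring R] (f : ℚ →+* R) (q : ℚ) (r : R) :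
    f q * r = r * f q := by
  have hd : f q.den * f (q.den : ℚ)⁻¹ = 1 := by
    rw [← map_mul, mul_inv_cancel₀ (Nat.cast_ne_zero.2 q.den_ne_zero), map_one]
  have hd' : f (q.den : ℚ)⁻¹ * f q.den = 1 := by
    rw [← map_mul, inv_mul_cancel₀ (Nat.cast_ne_zero.2 q.den_ne_zero), map_one]
  have hc : Commute (f (q.den : ℚ)⁻¹) r :=
    Commute.units_inv_left (u := ⟨f q.den, f (q.den : ℚ)⁻¹, hd, hd'⟩)
      (by simpa using Nat.cast_commute q.den r)
  have hn : Commute (f (q.num : ℚ)) r := by simp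
  have hq : f q = f (q.num : ℚ) * f (q.den : ℚ)⁻¹ := by
    rw [← map_mul, ← div_eq_mul_inv, Rat.num_div_den]
  rw [hq]
  exact hn.mul_left hc

namespace Triangulation

variable {n : ℕ} (Δ : Triangulation n)

/-- The row expansions survive under `g`, and together with invertibility of the off-diagonal values
they give all exchange relations in `R'`. Uniqueness holds because inverses are determined by the
elements they invert. -/
theorem isUniversalLocalization (hn : 2 ≤ n) :
    IsUniversalLocalization.{v} Δ.xMonoid Δ.inclusion := by
  refine ⟨fun s hs => ?_, fun R' _ g hg => ?_⟩
  · induction hs using Submonoid.closure_induction with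
    | mem a ha =>
      obtain ⟨i, j, h, ha⟩ := ha
      change IsUnit (a : PolygonAlgebra n)
      rw [ha]
      exact isUnit_x i j h
    | one => rw [map_one]; exact isUnit_one
    | mul a b _ _ ha hb => rw [map_mul]; exact ha.mul hb
  -- `R'` is only a ring; `g` itself supplies its `ℚ`-algebra structure, since the image of `ℚ` is
  -- central.
  · let : Algebra ℚ R' := (g.comp (algebraMap ℚ Δ.subalgebra)).toAlgebra' (ringHom_rat_commute _)
    have hgx : ∀ i j (h : i ≠ j), IsUnit (g ⟨x i j h, Δ.x_mem i j h⟩) := fun i j h =>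
      hg _ (Submonoid.subset_closure ⟨i, j, h, rfl⟩)
    set m : Fin n → Fin n → R' := fun i j => g ⟨signedX i j, Δ.signedX_mem i j⟩ with hm
    have hm_lt : ∀ i j (h : i < j), m i j = g ⟨x i j h.ne, Δ.x_mem i j h.ne⟩ := fun i j h =>
      congrArg g (Subtype.ext (signedX_of_lt h))
    have hm_gt : ∀ i j (h : j < i), m i j = -g ⟨x i j h.ne', Δ.x_mem i j h.ne'⟩ := fun i j h => by
      rw [← map_neg]
      exact congrArg g (Subtype.ext (signedX_of_gt h))
    have hp : IsPolygon m := by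
      refine isPolygon_of_row (Δ := Δ) (τ := m) hn (fun i => ?_) (fun i j h => ?_)
        (fun c a b h l => ?_)
      · have : (⟨signedX i i, Δ.signedX_mem i i⟩ : Δ.subalgebra) = 0 := Subtype.ext (signedX_self i)
        rw [hm]
        simp only
        rw [this, map_zero]
      · rcases lt_or_gt_of_ne h with hij | hij
        · rw [hm_lt i j hij]; exact hgx i j h
        · rw [hm_gt i j hij]; exact (hgx i j h).neg
      · simp only [hm]
        rw [← map_ringInverse g (Δ.isUnit_signedX_subalgebra h.base_mem),
          ← map_ringInverse g (Δ.isUnit_signedX_subalgebra (Δ.swap_mem h.base_mem)),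
          Δ.signedX_subalgebra_row h l]
        simp only [map_add, map_mul]
    have hlift : ∀ i j h, hp.lift (x i j h) = g ⟨x i j h, Δ.x_mem i j h⟩ := fun i j h => by
      rw [hp.lift_x]
      rcases lt_or_gt_of_ne h with hij | hij
      · rw [if_pos hij, hm_lt i j hij]
      · rw [if_neg hij.not_gt, hm_gt i j hij, neg_neg]
    let g' : Δ.subalgebra →ₐ[ℚ] R' := { g with commutes' := fun _ => rfl }
    have hext : hp.lift.comp Δ.subalgebra.val = g' := by
      refine AlgHom.adjoin_ext ?_
      rintro a (⟨i, j, h, rfl⟩ | ⟨i, j, h, rfl⟩)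
      · exact hlift i j h
      · have h1 := map_ringInverse hp.lift (isUnit_x i j (Δ.ne h))
        have h2 := map_ringInverse g (Δ.xUnit ⟨(i, j), h⟩).isUnit
        rw [ringInverse_x, hlift] at h1
        rw [Ring.inverse_unit] at h2
        exact h1.trans h2.symm
    refine ⟨hp.lift.toRingHom, RingHom.ext fun a => AlgHom.congr_fun hext a, fun h' hh' => ?_⟩
    -- Any ring homomorphism between `ℚ`-algebras is `ℚ`-linear, so uniqueness among algebra
    -- homomorphisms suffices.
    let f' : PolygonAlgebra n →ₐ[ℚ] R' :=
      { h' with commutes' := fun q => h'.map_rat_algebraMap q }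
    have hf' : f' = hp.lift := algHom_ext_x fun i j h =>
      (RingHom.congr_fun hh' ⟨x i j h, Δ.x_mem i j h⟩).trans (hlift i j h).symm
    exact RingHom.ext fun a => AlgHom.congr_fun hf' a

end Triangulation

end NCPolygon

/-- For every triangulation `Δ` of the `n`-gon, `𝐢_Δ : ℚ𝕋_Δ → 𝒜_Δ` is an isomorphism of algebras, and
`𝒜_n` (with the inclusion of `𝒜_Δ`) is the universal localization of `𝒜_Δ` by the submonoid
generated by all `x_{ij}`. -/
theorem theorem2p3 (n : ℕ) (hn : 2 ≤ n) (Δ : NCPolygon.Triangulation n) :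
    Function.Bijective Δ.iHom ∧
      NCPolygon.IsUniversalLocalization.{v} Δ.xMonoid Δ.inclusion :=
  ⟨⟨NCPolygon.Triangulation.iHom_injective hn, NCPolygon.Triangulation.iHom_surjective⟩,
    Δ.isUniversalLocalization hn⟩
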